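/- Let $\Omega$ be a finite alphabet with $A$ letters, let $k\ge 0$, and let $M:\Omega\times\Omega^k\to(0,1)$, $(a,w)\mapsto M(a\mid w)$, be a $k$th-order Markov kernel, i.e. $\sum_{a\in\Omega}M(a\mid w)=1$ for all $w\in\Omega^k$. Let $\pi$ be its stationary distribution, i.e. the probability distribution on $\Omega^k$ with $\pi(a_2^{k+1})=\sum_{a_1\in\Omega}M(a_{k+1}\mid a_1^k)\,\pi(a_1^k)$, and let $$H(M):=-\sum_{a_1^k\in\Omega^k}\pi(a_1^k)\sum_{b\in\Omega}M(b\mid a_1^k)\log M(b\mid a_1^k)$$ be the entropy rate. *The game.* In the time-homogeneous $k$th-order Markovian predictive game, Skeptic's capital starts at $K_0=1$. In each round $n=1,2,\dots$, Forecaster announces $p_n:\Omega\to(0,1)$ with $\sum_a p_n(a)=1$, where $p_n(a)=M(a\mid\omega_{n-k}^{n-1})$ if $n>k$ (and $p_n$ is arbitrary if $n\le k$); Skeptic announces $\alpha_n\in\mathbb R^\Omega$; Reality announces $\omega_n\in\Omega$; and $$K_n:=K_{n-1}\Big\{1+\sum_{a\in\Omega}\alpha_n(a)\big(\delta_{\omega_n}(a)-p_n(a)\big)\Big\}.$$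 A strategy of Skeptic is a map $\alpha:\Omega^*\to\mathbb R^\Omega$, played as $\alpha_n=\alpha(\omega_1^{n-1})$; it is prudent if $K_n>0$ for all $n$, whatever the moves of Forecaster and Reality. *The Lempel–Ziv probability.* Incremental parsing cuts a word, from left to right, into phrases, each being the shortest word that is not among the previous phrases; thus $\omega_1^{n-1}$ is cut into distinct phrases $x_1,\dots,x_T$ followed by a (possibly empty) remainder $r$. Let $V$ be the set of words $\xi\notin\{\lambda,x_1,\dots,x_T\}$ of the form $\xi=xb$ with $x\in\{\lambda,x_1,\dots,x_T\}$ and $b\in\Omega$, where $\lambda$ is the empty word. Put $$Q_{LZ}(a\mid\omega_1^{n-1}):=\frac{|\{\xi\in V: ra \text{ is a prefix of }\xi\}|}{|\{\xi\in V: r\text{ is a prefix of }\xi\}|},\qquad Q_{LZ}(\omega_1^n):=\prod_{i=1}^n Q_{LZ}(\omega_i\mid\omega_1^{i-1})$$ (so $Q_{LZ}(a\mid\lambda)=1/A$). **Proposition.** In the time-homogeneous $k$th-order Markovian predictive game, Skeptic has a prudent strategy $\alpha:\Omega^*\to\mathbb R^\Omega$ that ensures $\lim_{n\to\infty}K_n=\infty$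 unless $$\lim_{n\to\infty}\frac{-\log Q_{LZ}(\omega_1^n)}{n}=H(M).$$ -/

import Mathlib

/-!
Words are lists over a finite alphabet `Ω`.  An infinite sequence `ω₁ω₂ω₃⋯` is a function
`ω : ℕ → Ω`, with `ω i` the letter in position `i + 1`; likewise `p n` is Forecaster's
announcement in round `n + 1`.
-/

namespace LZGame

/-- The word `ω₁ ⋯ ωₙ`. -/
def pre {Ω : Type*} (ω : ℕ → Ω) (n : ℕ) : List Ω :=
  (List.range n).map ω

section LempelZiv

variable {Ω : Type*} [DecidableEq Ω]

/-- One letter of incremental parsing.  The state consists of the phrases marked off so far and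
the current incomplete phrase; a slash is set as soon as the latter is a new phrase. -/
def parseStep (s : List (List Ω) × List Ω) (a : Ω) : List (List Ω) × List Ω :=
  if s.2 ++ [a] ∈ s.1 then (s.1, s.2 ++ [a]) else (s.1 ++ [s.2 ++ [a]], [])

/-- Incremental parsing of a word: the list of its parsed phrases, in order, and the (possibly
empty) remaining word behind the last slash. -/
def parse (w : List Ω) : List (List Ω) × List Ω :=
  w.foldl parseStep ([], [])

variable [Fintype Ω]

/-- The set of candidates for the next phrase: the words that extend a parsed phrase or the empty
word by one letter and are neither a parsed phrase nor the empty word. -/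
def candidates (phrases : List (List Ω)) : Finset (List Ω) :=
  ((([] :: phrases).toFinset ×ˢ (Finset.univ : Finset Ω)).image
    fun x => x.1 ++ [x.2]).filter fun ξ => ξ ∉ [] :: phrases

/-- The number of candidates for the next phrase after the word `w` has been parsed which have
the word `x` as a prefix. -/
def numCandidates (w x : List Ω) : ℕ :=
  ((candidates (parse w).1).filter fun ξ => x <+: ξ).card

/-- The Lempel–Ziv conditional probability of the letter `a` after the word `w`.
For the empty word it is `1 / |Ω|`. -/
noncomputable def condLZ (a : Ω) (w : List Ω) : ℝ :=
  (numCandidates w ((parse w).2 ++ [a]) : ℝ) / (numCandidates w (parse w).2 : ℝ)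

/-- The Lempel–Ziv probability of the word `ω₁ ⋯ ωₙ`. -/
noncomputable def probLZ (ω : ℕ → Ω) (n : ℕ) : ℝ :=
  ∏ i ∈ Finset.range n, condLZ (ω i) (pre ω i)

end LempelZiv

section Game

variable {Ω : Type*} [Fintype Ω]

/-- Strictly positive probability functions with values in the open unit interval. -/
structure IsForecast (p : Ω → ℝ) : Prop where
  mem_Ioo : ∀ a, p a ∈ Set.Ioo (0 : ℝ) 1
  sum_eq_one : ∑ a, p a = 1

/-- `M a w` stands for `M(a ∣ w)`. -/
def IsMarkovKernel {k : ℕ} (M : Ω → (Fin k → Ω) → ℝ) : Prop :=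
  ∀ w, IsForecast fun a => M a w

/-- Stationary distributions of a `k`-th order Markov kernel: probability distributions `π` on
words of length `k` such that `π(a₂ ⋯ aₖ₊₁) = ∑ M(aₖ₊₁ ∣ a₁ ⋯ aₖ) π(a₁ ⋯ aₖ)`, where the sum
is over the letter `a₁`. -/
structure IsStationary {k : ℕ} (M : Ω → (Fin k → Ω) → ℝ) (π : (Fin k → Ω) → ℝ) : Prop where
  nonneg : ∀ w, 0 ≤ π w
  sum_eq_one : ∑ w, π w = 1
  invariant : ∀ c : Fin k → Ω, π c = ∑ d : Ω,
    M ((Fin.cons d c : Fin (k + 1) → Ω) (Fin.last k)) (Fin.init (Fin.cons d c : Fin (k + 1) → Ω)) *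
      π (Fin.init (Fin.cons d c : Fin (k + 1) → Ω))

/-- The entropy rate of `M`, where `π` is the stationary distribution of `M`. -/
noncomputable def entropyRate {k : ℕ} (M : Ω → (Fin k → Ω) → ℝ) (π : (Fin k → Ω) → ℝ) : ℝ :=
  -∑ w, π w * ∑ b, M b w * Real.log (M b w)

/-- The moves `p` of Forecaster and `ω` of Reality obey the protocol of the time-homogeneous
`k`-th order Markovian predictive game: in every round Forecaster announces a strictly positive
probability function, which from round `k + 1` on is given by `M` and the last `k` moves of
Reality.  The first `k` announcements are free. -/
structure IsPlay {k : ℕ} (M : Ω → (Fin k → Ω) → ℝ) (p : ℕ → Ω → ℝ) (ω : ℕ → Ω) : Prop where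
  forecast : ∀ n, IsForecast (p n)
  markov : ∀ n, k ≤ n → ∀ a, p n a = M a fun i : Fin k => ω (n - k + i)

/-- Skeptic's capital after `n` rounds, starting from `1`, with the strategy `α`, which assigns
to Reality's past moves the bets per unit of the present capital. -/
noncomputable def capital [DecidableEq Ω] (α : List Ω → Ω → ℝ) (p : ℕ → Ω → ℝ) (ω : ℕ → Ω) :
    ℕ → ℝ
  | 0 => 1
  | n + 1 => capital α p ω n *
      (1 + ∑ a, α (pre ω n) a * ((if ω n = a then 1 else 0) - p n a))

/-- A strategy is prudent if the capital stays positive, whatever the other players do. -/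
def IsPrudent [DecidableEq Ω] {k : ℕ} (M : Ω → (Fin k → Ω) → ℝ) (α : List Ω → Ω → ℝ) : Prop :=
  ∀ p ω, IsPlay M p ω → ∀ n, 0 < capital α p ω n

end Game

end LZGame

/-! The last `k` letters form the state of a finite irreducible chain. Let P be the probability of a
word under `M` from a fixed initial state, Q its Lempel–Ziv probability and T its number of phrases.
Three facts force -log Q / n → H. Since Q is a semimeasure, Q/P is a nonnegative supermartingale;
while it stays below n² at time n, -log Q ≥ -log P - 2 log n (`isSupermartingale_wordLZ_div`). By
the Poisson equation (`exists_poisson`), -log P - nH is, up to a bounded term, a martingale with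
bounded increments; while its exponential supermartingales stay below n², it is O(√n log n)
(`isSupermartingale_exp`, `tendsto_div_of_exp_lt`). Finally, for every single sequence, -log Q ≤
-log P + o(n): telescoping gives -log Q ≤ (T+1) log(A(T+1)), Ziv's inequality
(`log_runProb_le_of_nodup`) bounds -log P below by T log T up to lower order, and T = o(n)
(`neg_log_wordLZ_le_add`, `tendsto_redundancy`). So failure of the limit makes some supermartingale
exceed n² at infinitely many times n. `exists_supermartingale_tendsto_atTop` merges the family into
one positive supermartingale that then tends to infinity, and Skeptic's capital dominates a constant
multiple of it (`div_le_capital_followStrategy`). -/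

namespace LZGame

section Words

variable {Ω : Type*}

@[simp] theorem pre_zero (ω : ℕ → Ω) : pre ω 0 = [] := rfl

theorem pre_succ (ω : ℕ → Ω) (n : ℕ) : pre ω (n + 1) = pre ω n ++ [ω n] := by
  simp [pre, List.range_succ]

@[simp] theorem length_pre (ω : ℕ → Ω) (n : ℕ) : (pre ω n).length = n := by
  simp [pre]

theorem take_pre (ω : ℕ → Ω) {N n : ℕ} (h : N ≤ n) : (pre ω n).take N = pre ω N := by
  simp [pre, ← List.map_take, List.take_range, h]

end Words

/-! ### Incremental parsing and the Lempel–Ziv code length. -/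

section Parsing

variable {Ω : Type*} [DecidableEq Ω]

theorem parse_append_singleton (w : List Ω) (a : Ω) :
    parse (w ++ [a]) = parseStep (parse w) a := by
  simp [parse, List.foldl_append]

theorem parse_flatten (w : List Ω) : (parse w).1.flatten ++ (parse w).2 = w := by
  induction w using List.reverseRecOn with
  | nil => rfl
  | append_singleton w a ih =>
    rw [parse_append_singleton, parseStep]
    conv_rhs => rw [← ih]
    split_ifs <;> simp

theorem parse_nodup (w : List Ω) : (parse w).1.Nodup := by
  induction w using List.reverseRecOn with
  | nil => exact List.nodup_nil
  | append_singleton w a ih =>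
    rw [parse_append_singleton, parseStep]
    split_ifs with h
    · exact ih
    · rw [List.nodup_append]
      refine ⟨ih, List.nodup_singleton _, ?_⟩
      rintro x hx y hy rfl
      exact h (List.mem_singleton.1 hy ▸ hx)

theorem ne_nil_of_mem_parse (w : List Ω) : ∀ x ∈ (parse w).1, x ≠ [] := by
  induction w using List.reverseRecOn with
  | nil => simp [parse]
  | append_singleton w a ih =>
    rw [parse_append_singleton, parseStep]
    split_ifs with h
    · exact ih
    · intro x hx
      rcases List.mem_append.1 hx with hx | hx
      · exact ih x hx
      · simp_all

theorem parse_snd_mem (w : List Ω) : (parse w).2 ∈ [] :: (parse w).1 := by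
  induction w using List.reverseRecOn with
  | nil => simp [parse]
  | append_singleton w a ih =>
    rw [parse_append_singleton, parseStep]
    split_ifs with h <;> simp_all

theorem length_flatten_parse_le (w : List Ω) :
    ((parse w).1.map List.length).sum ≤ w.length := by
  conv_rhs => rw [← parse_flatten w]
  simp [List.length_flatten]

variable [Fintype Ω]

theorem mem_candidates {l : List (List Ω)} {x : List Ω} {a : Ω} (hx : x ∈ [] :: l)
    (h : x ++ [a] ∉ l) : x ++ [a] ∈ candidates l := by
  simp only [candidates, Finset.mem_filter, Finset.mem_image, Finset.mem_product, Prod.exists]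
  exact ⟨⟨x, a, ⟨by simpa using hx, Finset.mem_univ _⟩, rfl⟩, by simpa using h⟩

theorem card_candidates_le (l : List (List Ω)) :
    (candidates l).card ≤ Fintype.card Ω * (l.length + 1) := by
  refine (Finset.card_filter_le _ _).trans (Finset.card_image_le.trans ?_)
  rw [Finset.card_product, mul_comm]
  exact Nat.mul_le_mul le_rfl (List.toFinset_card_le _)

theorem numCandidates_le_card_mul (w x : List Ω) :
    numCandidates w x ≤ Fintype.card Ω * ((parse w).1.length + 1) :=
  (Finset.card_filter_le _ _).trans (card_candidates_le _)

/-- Every node of the parsing tree is a prefix of some candidate. -/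
theorem numCandidates_pos_of_mem [Nonempty Ω] (w : List Ω) {x : List Ω}
    (hx : x ∈ [] :: (parse w).1) : 0 < numCandidates w x := by
  -- A longest node `y` below `x`: one more letter leaves the tree, hence gives a candidate.
  obtain ⟨y, hy, hmax⟩ := Finset.exists_max_image
    (([] :: (parse w).1).toFinset.filter fun y => x <+: y) List.length
    ⟨x, by simpa using hx⟩
  rw [Finset.mem_filter, List.mem_toFinset] at hy
  obtain ⟨a⟩ := ‹Nonempty Ω›
  refine Finset.card_pos.2 ⟨y ++ [a], Finset.mem_filter.2
    ⟨mem_candidates hy.1 fun h => ?_, hy.2.trans (List.prefix_append _ _)⟩⟩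
  have := hmax (y ++ [a]) (by
    rw [Finset.mem_filter, List.mem_toFinset]
    exact ⟨List.mem_cons_of_mem _ h, hy.2.trans (List.prefix_append _ _)⟩)
  simp at this

theorem numCandidates_pos [Nonempty Ω] (w : List Ω) : 0 < numCandidates w (parse w).2 :=
  numCandidates_pos_of_mem w (parse_snd_mem w)

theorem numCandidates_append_pos [Nonempty Ω] (w : List Ω) (a : Ω) :
    0 < numCandidates w ((parse w).2 ++ [a]) := by
  by_cases h : (parse w).2 ++ [a] ∈ (parse w).1
  · exact numCandidates_pos_of_mem w (List.mem_cons_of_mem _ h)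
  · exact Finset.card_pos.2 ⟨_, Finset.mem_filter.2
      ⟨mem_candidates (parse_snd_mem w) h, List.prefix_rfl⟩⟩

theorem condLZ_pos [Nonempty Ω] (a : Ω) (w : List Ω) : 0 < condLZ a w :=
  div_pos (Nat.cast_pos.2 (numCandidates_append_pos w a)) (Nat.cast_pos.2 (numCandidates_pos w))

theorem sum_numCandidates_le (w x : List Ω) :
    ∑ a, numCandidates w (x ++ [a]) ≤ numCandidates w x := by
  unfold numCandidates
  rw [← Finset.card_biUnion]
  · refine Finset.card_le_card fun ξ hξ => ?_
    simp only [Finset.mem_biUnion, Finset.mem_filter, Finset.mem_univ, true_and] at hξ ⊢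
    obtain ⟨a, h, hp⟩ := hξ
    exact ⟨h, (List.prefix_append _ _).trans hp⟩
  · intro a _ b _ hab
    rw [Function.onFun, Finset.disjoint_left]
    intro ξ ha hb
    have ha := (Finset.mem_filter.1 ha).2
    have hb := (Finset.mem_filter.1 hb).2
    have := (List.prefix_of_prefix_length_le ha hb (by simp)).eq_of_length (by simp)
    exact hab (by simpa using this)

/-- An inequality suffices, as the likelihood ratio need only be a supermartingale. -/
theorem sum_condLZ_le_one (w : List Ω) : ∑ a, condLZ a w ≤ 1 := by
  unfold condLZ
  rw [← Finset.sum_div]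
  refine div_le_one_of_le₀ ?_ (Nat.cast_nonneg _)
  exact_mod_cast sum_numCandidates_le w _

/-- The Lempel–Ziv probability of the word `v` as a continuation of the word `u`. -/
noncomputable def wordLZ : List Ω → List Ω → ℝ
  | _, [] => 1
  | u, a :: v => condLZ a u * wordLZ (u ++ [a]) v

theorem wordLZ_append_singleton (u v : List Ω) (a : Ω) :
    wordLZ u (v ++ [a]) = wordLZ u v * condLZ a (u ++ v) := by
  induction v generalizing u with
  | nil => simp [wordLZ]
  | cons b v ih => simp [wordLZ, ih, mul_assoc]

theorem wordLZ_pos [Nonempty Ω] (u v : List Ω) : 0 < wordLZ u v := by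
  induction v generalizing u with
  | nil => exact one_pos
  | cons b v ih => exact mul_pos (condLZ_pos _ _) (ih _)

theorem probLZ_eq_wordLZ (ω : ℕ → Ω) (n : ℕ) : probLZ ω n = wordLZ [] (pre ω n) := by
  induction n with
  | zero => simp [probLZ, wordLZ]
  | succ n ih =>
    rw [pre_succ, wordLZ_append_singleton, ← ih, probLZ, Finset.prod_range_succ]
    simp [probLZ]

/-- Inside a phrase the conditional probabilities telescope: each numerator is the next denominator.
When a phrase ends, the numerator is at least 1, and the next denominator is at most the new factor
of the product. -/
theorem numCandidates_le_wordLZ_mul [Nonempty Ω] (w : List Ω) :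
    (numCandidates w (parse w).2 : ℝ) ≤ wordLZ [] w *
      ∏ t ∈ Finset.range ((parse w).1.length + 1), ((Fintype.card Ω * (t + 1) : ℕ) : ℝ) := by
  induction w using List.reverseRecOn with
  | nil =>
    have := numCandidates_le_card_mul ([] : List Ω) []
    simp only [parse, List.foldl_nil, wordLZ, List.length_nil, Finset.range_one,
      Finset.prod_singleton, one_mul, zero_add] at this ⊢
    exact_mod_cast this
  | append_singleton w a ih =>
    have hr : (0 : ℝ) < numCandidates w (parse w).2 := Nat.cast_pos.2 (numCandidates_pos w)
    have key : (numCandidates w ((parse w).2 ++ [a]) : ℝ) ≤ wordLZ [] (w ++ [a]) *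
        ∏ t ∈ Finset.range ((parse w).1.length + 1), ((Fintype.card Ω * (t + 1) : ℕ) : ℝ) := by
      rw [wordLZ_append_singleton, List.nil_append, condLZ, mul_right_comm]
      calc (numCandidates w ((parse w).2 ++ [a]) : ℝ)
          = numCandidates w (parse w).2 *
            (numCandidates w ((parse w).2 ++ [a]) / numCandidates w (parse w).2) := by
            field_simp
        _ ≤ _ := mul_le_mul_of_nonneg_right ih (by positivity)
    by_cases h : (parse w).2 ++ [a] ∈ (parse w).1
    · have hp : parse (w ++ [a]) = ((parse w).1, (parse w).2 ++ [a]) := by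
        rw [parse_append_singleton, parseStep, if_pos h]
      have : numCandidates (w ++ [a]) ((parse w).2 ++ [a]) =
          numCandidates w ((parse w).2 ++ [a]) := by
        simp only [numCandidates, hp]
      rw [hp]
      simp only [this]
      exact key
    · have hp : parse (w ++ [a]) = ((parse w).1 ++ [(parse w).2 ++ [a]], []) := by
        rw [parse_append_singleton, parseStep, if_neg h]
      have h1 : (1 : ℝ) ≤ numCandidates w ((parse w).2 ++ [a]) :=
        Nat.one_le_cast.2 (numCandidates_append_pos w a)
      have h2 := numCandidates_le_card_mul (w ++ [a]) (parse (w ++ [a])).2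
      have hl : (parse (w ++ [a])).1.length = (parse w).1.length + 1 := by simp [hp]
      rw [hl] at h2 ⊢
      rw [Finset.prod_range_succ, ← mul_assoc]
      exact (Nat.cast_le.2 h2).trans (le_mul_of_one_le_left (Nat.cast_nonneg _) (h1.trans key))

theorem neg_log_wordLZ_le [Nonempty Ω] (w : List Ω) :
    -Real.log (wordLZ [] w) ≤ ((parse w).1.length + 1) *
      Real.log (Fintype.card Ω * ((parse w).1.length + 1)) := by
  have hpos := wordLZ_pos [] w
  set T := (parse w).1.length with hT
  have h : (1 : ℝ) ≤ wordLZ [] w * (Fintype.card Ω * (T + 1) : ℝ) ^ (T + 1) := by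
    have h1 : (1 : ℝ) ≤ numCandidates w (parse w).2 := Nat.one_le_cast.2 (numCandidates_pos w)
    refine h1.trans ((numCandidates_le_wordLZ_mul w).trans ?_)
    refine mul_le_mul_of_nonneg_left ?_ hpos.le
    refine (Finset.prod_le_prod (g := fun _ => (Fintype.card Ω * (T + 1) : ℝ))
      (fun t _ => Nat.cast_nonneg _) fun t ht => ?_).trans ?_
    · have := Finset.mem_range.1 ht
      have h2 : Fintype.card Ω * (t + 1) ≤ Fintype.card Ω * (T + 1) :=
        Nat.mul_le_mul le_rfl (by omega)
      exact_mod_cast h2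
    · simp [← hT]
  have hA : (0 : ℝ) < Fintype.card Ω := Nat.cast_pos.2 Fintype.card_pos
  have h3 := Real.log_nonneg h
  rw [Real.log_mul hpos.ne' (by positivity), Real.log_pow] at h3
  push_cast at h3
  linarith

end Parsing

/-! ### Finite-state sources and Ziv's inequality. -/

section Automaton

variable {Ω S : Type*}

/-- The probability with which a source with state transitions `step` and output probabilities
`m` emits a given word when started in a given state. -/
def runProb (step : S → Ω → S) (m : S → Ω → ℝ) : S → List Ω → ℝ
  | _, [] => 1
  | s, a :: w => m s a * runProb step m (step s a) w

variable {step : S → Ω → S} {m : S → Ω → ℝ}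

theorem runProb_append (s : S) (u v : List Ω) :
    runProb step m s (u ++ v) = runProb step m s u * runProb step m (u.foldl step s) v := by
  induction u generalizing s with
  | nil => simp [runProb]
  | cons a u ih => simp [runProb, ih, mul_assoc]

theorem runProb_append_singleton (s : S) (w : List Ω) (a : Ω) :
    runProb step m s (w ++ [a]) = runProb step m s w * m (w.foldl step s) a := by
  simp [runProb_append, runProb]

theorem runProb_pos (hm : ∀ s a, 0 < m s a) (s : S) (w : List Ω) : 0 < runProb step m s w := by
  induction w generalizing s with
  | nil => exact one_pos
  | cons a w ih => exact mul_pos (hm _ _) (ih _)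

/-- Summing over all states in which a phrase may start makes its bound independent of the earlier
phrases. -/
theorem log_runProb_flatten_le [Fintype S] (hm : ∀ s a, 0 < m s a) (s : S) (ph : List (List Ω)) :
    Real.log (runProb step m s ph.flatten) ≤
      (ph.map fun x => Real.log (∑ t, runProb step m t x)).sum := by
  induction ph generalizing s with
  | nil => simp [runProb]
  | cons x ph ih =>
    rw [List.flatten_cons, runProb_append, Real.log_mul (runProb_pos hm _ _).ne'
      (runProb_pos hm _ _).ne', List.map_cons, List.sum_cons]
    refine add_le_add (Real.log_le_log (runProb_pos hm _ _) ?_) (ih _)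
    exact Finset.single_le_sum (f := fun t => runProb step m t x)
      (fun t _ => (runProb_pos hm _ _).le) (Finset.mem_univ s)

variable [Fintype Ω]

theorem sum_runProb_ofFn (hsum : ∀ s, ∑ a, m s a = 1) (l : ℕ) (s : S) :
    ∑ x : Fin l → Ω, runProb step m s (List.ofFn x) = 1 := by
  induction l generalizing s with
  | zero => simp [runProb]
  | succ l ih =>
    rw [← (Fin.consEquiv fun _ : Fin (l + 1) => Ω).sum_comp, Fintype.sum_prod_type]
    simp only [Fin.consEquiv, Equiv.coe_fn_mk, List.ofFn_succ, Fin.cons_zero, Fin.cons_succ,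
      runProb, ← Finset.mul_sum, ih, mul_one, hsum]

theorem sum_runProb_le_one (hm : ∀ s a, 0 < m s a) (hsum : ∀ s, ∑ a, m s a = 1) (l : ℕ) (s : S)
    (X : Finset (List Ω)) (hX : ∀ x ∈ X, x.length = l) : ∑ x ∈ X, runProb step m s x ≤ 1 := by
  classical
  rw [← sum_runProb_ofFn hsum l s, ← Finset.sum_image (g := List.ofFn) (s := Finset.univ)
    (f := runProb step m s) List.ofFn_injective.injOn]
  refine Finset.sum_le_sum_of_subset_of_nonneg (fun x hx => ?_) fun x _ _ => (runProb_pos hm _ _).le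
  obtain rfl := hX x hx
  exact Finset.mem_image.2 ⟨x.get, Finset.mem_univ _, List.ofFn_get x⟩

theorem sum_range_inv_mul_succ_le_one (L : ℕ) :
    ∑ l ∈ Finset.range L, ((l : ℝ) * (l + 1))⁻¹ ≤ 1 := by
  -- Telescoping sum; the term at `l = 0` is 0⁻¹ = 0.
  suffices h : ∑ l ∈ Finset.range (L + 1), ((l : ℝ) * (l + 1))⁻¹ = 1 - 1 / (L + 1) by
    rw [Finset.sum_range_succ] at h
    have h1 : (0 : ℝ) ≤ ((L : ℝ) * (L + 1))⁻¹ := by positivity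
    have h2 : (0 : ℝ) ≤ 1 / ((L : ℝ) + 1) := by positivity
    linarith
  induction L with
  | zero => simp
  | succ L ih =>
    rw [Finset.sum_range_succ, ih]
    push_cast
    field_simp
    ring

/-- A Kraft-type inequality for finite sets of words of arbitrary lengths. -/
theorem sum_weighted_runProb_le_one (hm : ∀ s a, 0 < m s a) (hsum : ∀ s, ∑ a, m s a = 1) (s : S)
    (X : Finset (List Ω)) :
    ∑ x ∈ X, ((x.length : ℝ) * (x.length + 1))⁻¹ * runProb step m s x ≤ 1 := by
  have hmaps : ∀ x ∈ X, x.length ∈ Finset.range (X.sup List.length + 1) := fun x hx =>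
    Finset.mem_range.2 (Nat.lt_succ_of_le (Finset.le_sup (f := List.length) hx))
  -- Words of one length have total probability at most 1, and the weights of the lengths sum to at
  -- most 1.
  rw [← Finset.sum_fiberwise_of_maps_to hmaps]
  refine le_trans (Finset.sum_le_sum fun l _ => ?_)
    (sum_range_inv_mul_succ_le_one (X.sup List.length + 1))
  calc ∑ x ∈ X with x.length = l, ((x.length : ℝ) * (x.length + 1))⁻¹ * runProb step m s x
      = ((l : ℝ) * (l + 1))⁻¹ * ∑ x ∈ X with x.length = l, runProb step m s x := by
        rw [Finset.mul_sum]
        refine Finset.sum_congr rfl fun x hx => ?_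
        rw [(Finset.mem_filter.1 hx).2]
    _ ≤ ((l : ℝ) * (l + 1))⁻¹ * 1 := by
        gcongr
        exact sum_runProb_le_one hm hsum l s _ fun x hx => (Finset.mem_filter.1 hx).2
    _ = _ := mul_one _

variable [Fintype S]

/-- Jensen's inequality for the logarithm, for an upper bound of a finite sum. -/
theorem sum_log_le_card_mul_log {ι : Type*} (X : Finset ι) (y : ι → ℝ) (hy : ∀ x ∈ X, 0 < y x)
    {B : ℝ} (hB : 0 < B) (h : ∑ x ∈ X, y x ≤ B) :
    ∑ x ∈ X, Real.log (y x) ≤ X.card * Real.log (B / X.card) := by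
  rcases X.eq_empty_or_nonempty with rfl | hX
  · simp
  have hT : (0 : ℝ) < X.card := Nat.cast_pos.2 hX.card_pos
  set c := B / X.card with hc
  have hc0 : 0 < c := div_pos hB hT
  -- The logarithm lies below its tangent at `c`.
  calc ∑ x ∈ X, Real.log (y x) ≤ ∑ x ∈ X, (Real.log c + (y x / c - 1)) := by
        refine Finset.sum_le_sum fun x hx => ?_
        have := Real.log_le_sub_one_of_pos (div_pos (hy x hx) hc0)
        rw [Real.log_div (hy x hx).ne' hc0.ne'] at this
        linarith
    _ = X.card * Real.log c + ((∑ x ∈ X, y x) / c - X.card) := by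
        simp [Finset.sum_add_distrib, Finset.sum_sub_distrib, Finset.sum_div]
    _ ≤ X.card * Real.log c + (B / c - X.card) := by gcongr
    _ = X.card * Real.log c := by
        rw [hc, div_div_cancel₀ hB.ne']; ring

/-- Ziv's inequality: a word that is a concatenation of many distinct phrases has a small
probability under every finite-state source. -/
theorem log_runProb_le_of_nodup [Nonempty S] (hm : ∀ s a, 0 < m s a) (hsum : ∀ s, ∑ a, m s a = 1)
    (s : S) (ph : List (List Ω)) (hnd : ph.Nodup) (hne : ∀ x ∈ ph, x ≠ []) {n : ℕ}
    (hn : (ph.map List.length).sum ≤ n) :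
    Real.log (runProb step m s ph.flatten) ≤
      ph.length * Real.log (Fintype.card S / ph.length) +
        2 * (ph.length * Real.log ((n + ph.length) / ph.length)) := by
  classical
  rcases ph.eq_nil_or_concat with rfl | hph
  · simp [runProb]
  have hph : ph ≠ [] := by
    rintro rfl
    obtain ⟨_, _, h⟩ := hph
    simp at h
  have hT : (0 : ℝ) < ph.length := Nat.cast_pos.2 (List.length_pos_iff.2 hph)
  have hcard : ph.toFinset.card = ph.length := List.toFinset_card_of_nodup hnd
  have hpos : ∀ x : List Ω, 0 < ∑ t, runProb step m t x := fun x =>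
    Finset.sum_pos (fun t _ => runProb_pos hm t x) Finset.univ_nonempty
  have hlen : ∀ x ∈ ph.toFinset, (0 : ℝ) < x.length := fun x hx =>
    Nat.cast_pos.2 (List.length_pos_iff.2 (hne x (List.mem_toFinset.1 hx)))
  -- Jensen for the weighted probabilities: the Kraft inequality, applied from each start state,
  -- bounds their sum by the number of states.
  have h1 := sum_log_le_card_mul_log ph.toFinset
    (fun x => ((x.length : ℝ) * (x.length + 1))⁻¹ * ∑ t, runProb step m t x)
    (fun x hx => by have := hlen x hx; have := hpos x; positivity)
    (B := Fintype.card S) (Nat.cast_pos.2 Fintype.card_pos) (by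
      simp only [Finset.mul_sum]
      rw [Finset.sum_comm]
      refine (Finset.sum_le_sum fun t _ =>
        sum_weighted_runProb_le_one hm hsum t ph.toFinset).trans ?_
      simp)
  have hsumlen : ∑ x ∈ ph.toFinset, ((x.length : ℝ) + 1) ≤ n + ph.length := by
    rw [Finset.sum_add_distrib, Finset.sum_const, hcard, nsmul_one,
      List.sum_toFinset (fun x : List Ω => (x.length : ℝ)) hnd]
    have : ((ph.map fun x : List Ω => (x.length : ℝ)).sum) =
        (((ph.map List.length).sum : ℕ) : ℝ) := by
      rw [Nat.cast_list_sum, List.map_map]; rfl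
    rw [this]
    gcongr
  -- Removing the weights costs at most 2 log(length + 1) per phrase; a second use of Jensen bounds
  -- the total.
  have h2 := sum_log_le_card_mul_log ph.toFinset (fun x => (x.length : ℝ) + 1)
    (fun x _ => by positivity) (B := n + ph.length) (by positivity) hsumlen
  rw [hcard] at h1 h2
  refine (log_runProb_flatten_le hm s ph).trans ?_
  rw [← List.sum_toFinset _ hnd]
  have h3 : ∑ x ∈ ph.toFinset, Real.log (∑ t, runProb step m t x) ≤
      ∑ x ∈ ph.toFinset,
        (Real.log (((x.length : ℝ) * (x.length + 1))⁻¹ * ∑ t, runProb step m t x) +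
          2 * Real.log ((x.length : ℝ) + 1)) := by
    refine Finset.sum_le_sum fun x hx => ?_
    have hx := hlen x hx
    rw [Real.log_mul (by positivity) (hpos x).ne', Real.log_inv,
      Real.log_mul hx.ne' (by positivity)]
    have := Real.log_le_log hx (by linarith : (x.length : ℝ) ≤ x.length + 1)
    linarith
  rw [Finset.sum_add_distrib, ← Finset.mul_sum] at h3
  linarith

end Automaton

/-! ### The number of phrases is o(n). -/

section PhraseCount

variable {Ω : Type*} [Fintype Ω] [DecidableEq Ω]

/-- Most of many distinct words are long. -/
theorem exists_mul_length_le (L : ℕ) : ∃ B : ℕ, ∀ ph : List (List Ω), ph.Nodup →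
    L * ph.length ≤ (ph.map List.length).sum + B := by
  have hfin := List.finite_length_lt Ω L
  -- Only the finitely many words shorter than `L` fall short, each by at most `L`.
  refine ⟨L * hfin.toFinset.card, fun ph hnd => ?_⟩
  have hcard : ph.toFinset.card = ph.length := List.toFinset_card_of_nodup hnd
  rw [← List.sum_toFinset _ hnd, ← hcard, ← Finset.card_filter_add_card_filter_not
    (s := ph.toFinset) (fun x => x.length < L), mul_add, add_comm]
  refine add_le_add ?_ (Nat.mul_le_mul le_rfl (Finset.card_le_card fun x hx => ?_))
  · rw [mul_comm, ← smul_eq_mul]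
    refine (Finset.card_nsmul_le_sum _ List.length L fun x hx => ?_).trans
      (Finset.sum_le_sum_of_subset (Finset.filter_subset _ _))
    exact not_lt.1 (Finset.mem_filter.1 hx).2
  · simpa using (Finset.mem_filter.1 hx).2

/-- The phrases are distinct with total length at most n, so L·T ≤ n + B ≤ 2n for large n; hence `L`
is taken above 2/ε. -/
theorem tendsto_length_parse_div (ω : ℕ → Ω) :
    Filter.Tendsto (fun n : ℕ => ((parse (pre ω n)).1.length : ℝ) / n) Filter.atTop (nhds 0) := by
  rw [Metric.tendsto_atTop]
  intro ε hε
  obtain ⟨L, hL⟩ := exists_nat_gt (2 / ε)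
  obtain ⟨B, hB⟩ := exists_mul_length_le (Ω := Ω) L
  refine ⟨B + 1, fun n hn => ?_⟩
  have hn0 : (0 : ℝ) < n := Nat.cast_pos.2 (by omega)
  have hL0 : (0 : ℝ) < L := (by positivity : (0 : ℝ) < 2 / ε).trans hL
  rw [Real.dist_eq, sub_zero, abs_of_nonneg (by positivity), div_lt_iff₀ hn0]
  have h : L * (parse (pre ω n)).1.length ≤ 2 * n := by
    have h1 := hB _ (parse_nodup (pre ω n))
    have h2 := length_flatten_parse_le (pre ω n)
    rw [length_pre] at h2
    omega
  have h' : (L : ℝ) * (parse (pre ω n)).1.length ≤ 2 * n := by exact_mod_cast h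
  rw [div_lt_iff₀ hε] at hL
  by_contra! hcon
  have := mul_le_mul_of_nonneg_left hcon hL0.le
  nlinarith

end PhraseCount

/-! ### Harmonic functions and the Poisson equation. -/

section Poisson

variable {S Ω : Type*} [Fintype S] [Fintype Ω]

/-- A function that is harmonic for a source all of whose states communicate is constant. -/
theorem harmonic_eq {step : S → Ω → S} {m : S → Ω → ℝ} (hm : ∀ s a, 0 < m s a)
    (hsum : ∀ s, ∑ a, m s a = 1) (hirr : ∀ s t, ∃ w : List Ω, w.foldl step s = t) {g : S → ℝ}
    (hg : ∀ s, ∑ a, m s a * g (step s a) = g s) (s t : S) : g s = g t := by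
  obtain ⟨s₀, -, hmax⟩ := Finset.exists_max_image Finset.univ g ⟨s, Finset.mem_univ s⟩
  -- Maximum principle: a maximum that is an average with positive weights is attained at every
  -- successor.
  have hstep : ∀ u, g u = g s₀ → ∀ a, g (step u a) = g s₀ := by
    intro u hu a
    have h0 : ∑ a, m u a * (g s₀ - g (step u a)) = 0 := by
      simp only [mul_sub, Finset.sum_sub_distrib, hg, ← Finset.sum_mul, hsum, hu]
      ring
    rw [Finset.sum_eq_zero_iff_of_nonneg fun a _ =>
      mul_nonneg (hm u a).le (sub_nonneg.2 (hmax _ (Finset.mem_univ _)))] at h0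
    have := (mul_eq_zero.1 (h0 a (Finset.mem_univ a))).resolve_left (hm u a).ne'
    linarith
  have hrun : ∀ w : List Ω, ∀ u, g u = g s₀ → g (w.foldl step u) = g s₀ := by
    intro w
    induction w with
    | nil => exact fun u hu => hu
    | cons a w ih => exact fun u hu => ih _ (hstep u hu a)
  have hall : ∀ u, g u = g s₀ := fun u => by
    obtain ⟨w, rfl⟩ := hirr s₀ u
    exact hrun w s₀ rfl
  rw [hall s, hall t]

/-- Solvability of the Poisson equation. -/
theorem exists_poisson {step : S → Ω → S} {m : S → Ω → ℝ} (hm : ∀ s a, 0 < m s a)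
    (hsum : ∀ s, ∑ a, m s a = 1) (hirr : ∀ s t, ∃ w : List Ω, w.foldl step s = t) {π : S → ℝ}
    (hπ : ∑ s, π s = 1) (hinv : ∀ g : S → ℝ, ∑ s, π s * ∑ a, m s a * g (step s a) = ∑ s, π s * g s)
    (f : S → ℝ) :
    ∃ g : S → ℝ, ∀ s, f s - ∑ t, π t * f t = g s - ∑ a, m s a * g (step s a) := by
  classical
  let T : (S → ℝ) →ₗ[ℝ] (S → ℝ) :=
    { toFun := fun g s => g s - ∑ a, m s a * g (step s a)
      map_add' := fun g h => by
        ext s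
        simp only [Pi.add_apply, mul_add, Finset.sum_add_distrib]
        ring
      map_smul' := fun c g => by
        ext s
        simp only [Pi.smul_apply, smul_eq_mul, RingHom.id_apply, mul_sub, Finset.mul_sum]
        congr 1
        exact Finset.sum_congr rfl fun a _ => by ring }
  let φ : (S → ℝ) →ₗ[ℝ] ℝ :=
    { toFun := fun g => ∑ s, π s * g s
      map_add' := fun g h => by simp only [Pi.add_apply, mul_add, Finset.sum_add_distrib]
      map_smul' := fun c g => by
        simp only [Pi.smul_apply, smul_eq_mul, RingHom.id_apply, Finset.mul_sum]
        exact Finset.sum_congr rfl fun a _ => by ring }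
  have hφ1 : φ (fun _ => 1) = 1 := by simpa [φ] using hπ
  have hker : Module.finrank ℝ (LinearMap.ker T) ≤ 1 := by
    have hle : LinearMap.ker T ≤ Submodule.span ℝ {fun _ : S => (1 : ℝ)} := by
      intro g hg
      have hg' : ∀ s, ∑ a, m s a * g (step s a) = g s := fun s => by
        have := congrFun (LinearMap.mem_ker.1 hg) s
        simp only [T, LinearMap.coe_mk, AddHom.coe_mk, Pi.zero_apply] at this
        linarith
      refine Submodule.mem_span_singleton.2 ⟨φ g, ?_⟩
      ext s
      have : φ g = ∑ t, π t * g s := Finset.sum_congr rfl fun t _ => by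
        rw [harmonic_eq hm hsum hirr hg' t s]
      rw [← Finset.sum_mul, hπ, one_mul] at this
      simp [this]
    exact (Submodule.finrank_mono hle).trans ((finrank_span_le_card _).trans (by simp))
  -- Fredholm alternative: invariance of `π` gives range T ⊆ ker φ. Since ker T has dimension at
  -- most 1 and φ has rank 1, rank–nullity gives equality.
  have hrange : LinearMap.range T = LinearMap.ker φ := by
    refine Submodule.eq_of_le_of_finrank_le ?_ ?_
    · rintro _ ⟨g, rfl⟩
      rw [LinearMap.mem_ker]
      change ∑ s, π s * (g s - ∑ a, m s a * g (step s a)) = 0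
      simp only [mul_sub, Finset.sum_sub_distrib, hinv, sub_self]
    · have h1 := LinearMap.finrank_range_add_finrank_ker T
      have h2 := LinearMap.finrank_range_add_finrank_ker φ
      have h3 : Module.finrank ℝ (LinearMap.range φ) = 1 := by
        have : LinearMap.range φ = ⊤ := by
          rw [LinearMap.range_eq_top]
          exact fun c => ⟨c • fun _ => 1, by rw [map_smul, hφ1, smul_eq_mul, mul_one]⟩
        rw [this, finrank_top, Module.finrank_self]
      omega
  have hmem : (fun s => f s - ∑ t, π t * f t) ∈ LinearMap.ker φ := by
    rw [LinearMap.mem_ker]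
    change ∑ s, π s * (f s - ∑ t, π t * f t) = 0
    simp only [mul_sub, Finset.sum_sub_distrib, ← Finset.sum_mul, hπ, one_mul, sub_self]
  rw [← hrange] at hmem
  obtain ⟨g, hg⟩ := hmem
  exact ⟨g, fun s => (congrFun hg s).symm⟩

end Poisson

/-! ### The chain of the last `k` letters. -/

section Shift

variable {Ω : Type*} {k : ℕ}

/-- The last `k` letters after one more letter has been appended. -/
def shift (s : Fin k → Ω) (a : Ω) : Fin k → Ω :=
  Fin.tail (Fin.snoc s a : Fin (k + 1) → Ω)

/-- From time `k` on the initial window `s` is forgotten, so the source may start anywhere. -/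
theorem foldl_shift_pre (s : Fin k → Ω) (ω : ℕ → Ω) (n : ℕ) (i : Fin k) (hi : k ≤ n + i) :
    (pre ω n).foldl shift s i = ω (n + i - k) := by
  induction n generalizing i with
  | zero => omega
  | succ n ih =>
    rw [pre_succ, List.foldl_append, List.foldl_cons, List.foldl_nil, shift, Fin.tail]
    by_cases h : (i : ℕ) + 1 < k
    · have : i.succ = Fin.castSucc (⟨i + 1, h⟩ : Fin k) := Fin.ext rfl
      rw [this, Fin.snoc_castSucc, ih _ (by simp only; omega)]
      congr 1
      simp only
      omega
    · have : i.succ = Fin.last k := Fin.ext (by simp; omega)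
      rw [this, Fin.snoc_last]
      congr 1
      omega

/-- Irreducibility: reading the letters of `t` overwrites any window. -/
theorem exists_foldl_shift_eq (s t : Fin k → Ω) : ∃ w : List Ω, w.foldl shift s = t := by
  rcases k.eq_zero_or_pos with rfl | hk
  · exact ⟨[], Subsingleton.elim _ _⟩
  refine ⟨pre (fun n => if h : n < k then t ⟨n, h⟩ else t ⟨0, hk⟩) k, ?_⟩
  ext i
  rw [foldl_shift_pre _ _ _ _ (by omega), Nat.add_sub_cancel_left, dif_pos i.2]

/-- Stationarity in the dual form used by `exists_poisson`. Both sides equal the sum of `G` over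
words of length `k + 1`, split at the last or at the first letter. -/
theorem IsStationary.sum_shift [Fintype Ω] {M : Ω → (Fin k → Ω) → ℝ} {π : (Fin k → Ω) → ℝ}
    (hπ : IsStationary M π) (g : (Fin k → Ω) → ℝ) :
    ∑ s, π s * ∑ a, M a s * g (shift s a) = ∑ s, π s * g s := by
  let G : (Fin (k + 1) → Ω) → ℝ := fun x =>
    M (x (Fin.last k)) (Fin.init x) * π (Fin.init x) * g (Fin.tail x)
  have h1 : ∑ x, G x = ∑ s, π s * ∑ a, M a s * g (shift s a) := by
    rw [← (Fin.snocEquiv fun _ : Fin (k + 1) => Ω).sum_comp, Fintype.sum_prod_type_right]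
    refine Finset.sum_congr rfl fun s _ => ?_
    rw [Finset.mul_sum]
    refine Finset.sum_congr rfl fun a _ => ?_
    simp only [G, Fin.snocEquiv, Equiv.coe_fn_mk, Fin.snoc_last, Fin.init_snoc, shift]
    ring
  have h2 : ∑ x, G x = ∑ s, π s * g s := by
    rw [← (Fin.consEquiv fun _ : Fin (k + 1) => Ω).sum_comp, Fintype.sum_prod_type_right]
    refine Finset.sum_congr rfl fun c _ => ?_
    rw [hπ.invariant c, Finset.sum_mul]
    refine Finset.sum_congr rfl fun d _ => ?_
    simp only [G, Fin.consEquiv, Equiv.coe_fn_mk, Fin.tail_cons]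
  rw [← h1, h2]

end Shift

open Filter Topology

/-! ### Supermartingales: stopping, merging, exponential bounds. -/

section Supermartingale

variable {Ω S : Type*} [Fintype Ω] {step : S → Ω → S} {m : S → Ω → ℝ} {s₀ : S}

/-- Nonnegative supermartingales with respect to a source started in the state `s₀`. -/
structure IsSupermartingale (step : S → Ω → S) (m : S → Ω → ℝ) (s₀ : S) (W : List Ω → ℝ) :
    Prop where
  nonneg : ∀ w, 0 ≤ W w
  sum_le : ∀ w, ∑ a, m (w.foldl step s₀) a * W (w ++ [a]) ≤ W w

theorem IsSupermartingale.add {V W : List Ω → ℝ} (hV : IsSupermartingale step m s₀ V)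
    (hW : IsSupermartingale step m s₀ W) : IsSupermartingale step m s₀ fun w => V w + W w where
  nonneg w := add_nonneg (hV.nonneg w) (hW.nonneg w)
  sum_le w := by
    simp only [mul_add, Finset.sum_add_distrib]
    exact add_le_add (hV.sum_le w) (hW.sum_le w)

/-- Stopping at time `N` preserves a large value reached at that time. -/
theorem IsSupermartingale.comp_take (hsum : ∀ s, ∑ a, m s a = 1) {W : List Ω → ℝ}
    (hW : IsSupermartingale step m s₀ W) (N : ℕ) :
    IsSupermartingale step m s₀ fun w => W (w.take N) where
  nonneg w := hW.nonneg _
  sum_le w := by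
    rcases le_or_gt N w.length with h | h
    · simp only [List.take_append_of_le_length h, ← Finset.sum_mul, hsum, one_mul, le_refl]
    · have h1 : ∀ a, (w ++ [a]).take N = w ++ [a] := fun a =>
        List.take_of_length_le (by simp; omega)
      simp only [h1, List.take_of_length_le h.le]
      exact hW.sum_le w

/-- Each letter multiplies `W` by at most 1/δ. For a family with bounded initial values this bound
is uniform, which makes the merged series converge. -/
theorem IsSupermartingale.le_pow (hm : ∀ s a, 0 < m s a) {δ : ℝ} (hδ : 0 < δ)
    (hδm : ∀ s a, δ ≤ m s a) {W : List Ω → ℝ} (hW : IsSupermartingale step m s₀ W) (w : List Ω) :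
    W w ≤ δ⁻¹ ^ w.length * W [] := by
  induction w using List.reverseRecOn with
  | nil => simp
  | append_singleton w a ih =>
    have h1 : δ * W (w ++ [a]) ≤ W w :=
      calc δ * W (w ++ [a]) ≤ m (w.foldl step s₀) a * W (w ++ [a]) :=
            mul_le_mul_of_nonneg_right (hδm _ _) (hW.nonneg _)
        _ ≤ ∑ b, m (w.foldl step s₀) b * W (w ++ [b]) :=
            Finset.single_le_sum (f := fun b => m (w.foldl step s₀) b * W (w ++ [b]))
              (fun b _ => mul_nonneg (hm _ _).le (hW.nonneg _)) (Finset.mem_univ a)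
        _ ≤ W w := hW.sum_le w
    rw [List.length_append, List.length_singleton, pow_succ']
    calc W (w ++ [a]) = δ⁻¹ * (δ * W (w ++ [a])) := by field_simp
      _ ≤ δ⁻¹ * (δ⁻¹ ^ w.length * W []) := by
          have := h1.trans ih
          gcongr
      _ = _ := by ring

/-- A Borel–Cantelli lemma: a supermartingale that tends to infinity whenever infinitely many
members `W N` of a family of supermartingales are large at time `N`. -/
theorem exists_supermartingale_tendsto_atTop (hm : ∀ s a, 0 < m s a)
    (hsum : ∀ s, ∑ a, m s a = 1) {δ : ℝ} (hδ : 0 < δ) (hδm : ∀ s a, δ ≤ m s a)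
    {W : ℕ → List Ω → ℝ} (hW : ∀ N, IsSupermartingale step m s₀ (W N)) {B : ℝ}
    (hB : ∀ N, W N [] ≤ B) :
    ∃ F : List Ω → ℝ, IsSupermartingale step m s₀ F ∧ (∀ w, 0 < F w) ∧
      ∀ ω : ℕ → Ω, (∃ᶠ N : ℕ in atTop, (N : ℝ) ^ 2 ≤ W N (pre ω N)) →
        Tendsto (fun n => F (pre ω n)) atTop atTop := by
  have htake := fun N => (hW N).comp_take hsum N
  have hnn : ∀ (w : List Ω) (N : ℕ), 0 ≤ W N (w.take N) * ((N : ℝ) ^ 2)⁻¹ := fun w N =>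
    mul_nonneg ((hW N).nonneg _) (by positivity)
  have hsummable : ∀ w : List Ω, Summable fun N : ℕ => W N (w.take N) * ((N : ℝ) ^ 2)⁻¹ := by
    intro w
    refine Summable.of_nonneg_of_le (hnn w) (fun N => ?_)
      ((Real.summable_nat_pow_inv.2 one_lt_two).mul_left (δ⁻¹ ^ w.length * B))
    have h1 := (htake N).le_pow hm hδ hδm w
    simp only [List.take_nil] at h1
    have h2 := hB N
    gcongr
    exact h1.trans (by gcongr)
  have hpos : ∀ w : List Ω, 0 < 1 + ∑' N : ℕ, W N (w.take N) * ((N : ℝ) ^ 2)⁻¹ := fun w =>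
    add_pos_of_pos_of_nonneg one_pos (tsum_nonneg (hnn w))
  -- The summand 1 ensures positivity. If `W N` is at least N² at time `N ≥ 1`, its stopped term
  -- contributes at least 1 forever after.
  refine ⟨fun w => 1 + ∑' N : ℕ, W N (w.take N) * ((N : ℝ) ^ 2)⁻¹, ⟨fun w => (hpos w).le, ?_⟩,
    hpos, ?_⟩
  · intro w
    simp only [mul_add, mul_one, Finset.sum_add_distrib, hsum, ← tsum_mul_left]
    rw [← Summable.tsum_finsetSum fun a _ => (hsummable _).mul_left _]
    gcongr 1 + ?_
    refine Summable.tsum_le_tsum (fun N => ?_)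
      (summable_sum fun a _ => (hsummable _).mul_left _) (hsummable w)
    simp only [← mul_assoc, ← Finset.sum_mul]
    exact mul_le_mul_of_nonneg_right ((htake N).sum_le w) (by positivity)
  · intro ω hω
    rw [tendsto_atTop]
    intro b
    obtain ⟨c, hc⟩ := exists_nat_ge b
    -- The index 0 must be excluded: its weight is 0⁻¹ = 0.
    have hinf := Nat.frequently_atTop_iff_infinite.1 (hω.and_eventually (eventually_ge_atTop 1))
    obtain ⟨t, ht, htc⟩ := hinf.exists_subset_card_eq c
    filter_upwards [eventually_ge_atTop (t.sup id)] with n hn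
    have h1 : (c : ℝ) ≤ ∑ N ∈ t, W N ((pre ω n).take N) * ((N : ℝ) ^ 2)⁻¹ := by
      rw [← htc, ← nsmul_one]
      refine Finset.card_nsmul_le_sum _ _ _ fun N hN => ?_
      obtain ⟨h2, h3⟩ := ht hN
      rw [take_pre ω (N := N) ((Finset.le_sup (f := id) hN).trans hn), ← div_eq_mul_inv,
        one_le_div (by positivity)]
      exact h2
    have h2 := (hsummable (pre ω n)).sum_le_tsum t fun N _ => hnn _ N
    linarith

/-- The exponential supermartingale of a process with bounded, centred increments. -/
theorem isSupermartingale_exp (hm : ∀ s a, 0 < m s a) (hsum : ∀ s, ∑ a, m s a = 1)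
    {h : S → Ω → ℝ} (hmean : ∀ s, ∑ a, m s a * h s a = 0) {C : ℝ} (hC : ∀ s a, |h s a| ≤ C)
    {X : List Ω → ℝ} (hX : ∀ w a, X (w ++ [a]) = X w + h (w.foldl step s₀) a) {l : ℝ}
    (hl : |l| * C ≤ 1) :
    IsSupermartingale step m s₀ fun w => Real.exp (l * X w - l ^ 2 * C ^ 2 * w.length) where
  nonneg w := (Real.exp_pos _).le
  sum_le w := by
    set s := w.foldl step s₀
    -- e^x ≤ 1 + x + x² for |x| ≤ 1, whence the condition on `l`; the linear term then averages to
    -- zero.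
    have hterm : ∀ a, Real.exp (l * h s a) ≤ 1 + l * h s a + l ^ 2 * C ^ 2 := by
      intro a
      have habs : |l * h s a| ≤ |l| * C := by
        rw [abs_mul]
        exact mul_le_mul_of_nonneg_left (hC s a) (abs_nonneg _)
      have h1 := (abs_le.1 (Real.abs_exp_sub_one_sub_id_le (habs.trans hl))).2
      have h2 : (l * h s a) ^ 2 ≤ l ^ 2 * C ^ 2 := by
        rw [← sq_abs, ← sq_abs l, ← mul_pow]
        exact pow_le_pow_left₀ (abs_nonneg _) habs 2
      linarith
    have hmgf : ∑ a, m s a * Real.exp (l * h s a) ≤ Real.exp (l ^ 2 * C ^ 2) :=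
      calc ∑ a, m s a * Real.exp (l * h s a)
          ≤ ∑ a, m s a * (1 + l * h s a + l ^ 2 * C ^ 2) :=
            Finset.sum_le_sum fun a _ => mul_le_mul_of_nonneg_left (hterm a) (hm s a).le
        _ = (∑ a, m s a) * (1 + l ^ 2 * C ^ 2) + l * ∑ a, m s a * h s a := by
            rw [Finset.sum_mul, Finset.mul_sum, ← Finset.sum_add_distrib]
            exact Finset.sum_congr rfl fun a _ => by ring
        _ = l ^ 2 * C ^ 2 + 1 := by rw [hsum, hmean]; ring
        _ ≤ _ := Real.add_one_le_exp _
    calc ∑ a, m s a * Real.exp (l * X (w ++ [a]) - l ^ 2 * C ^ 2 * (w ++ [a]).length)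
        = (∑ a, m s a * Real.exp (l * h s a)) *
            (Real.exp (l * X w - l ^ 2 * C ^ 2 * w.length) * Real.exp (-(l ^ 2 * C ^ 2))) := by
          rw [Finset.sum_mul]
          refine Finset.sum_congr rfl fun a _ => ?_
          rw [mul_assoc (m s a), ← Real.exp_add, ← Real.exp_add, hX]
          congr 2
          push_cast [List.length_append, List.length_singleton]
          ring
      _ ≤ Real.exp (l ^ 2 * C ^ 2) *
            (Real.exp (l * X w - l ^ 2 * C ^ 2 * w.length) * Real.exp (-(l ^ 2 * C ^ 2))) := by
          gcongr
      _ = Real.exp (l * X w - l ^ 2 * C ^ 2 * w.length) := by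
          rw [mul_left_comm, ← Real.exp_add, add_neg_cancel, Real.exp_zero, mul_one]

/-- The likelihood ratio of the Lempel–Ziv probability and a source. -/
theorem isSupermartingale_wordLZ_div [DecidableEq Ω] [Nonempty Ω] (hm : ∀ s a, 0 < m s a) :
    IsSupermartingale step m s₀ fun w => wordLZ [] w / runProb step m s₀ w where
  nonneg w := (div_pos (wordLZ_pos _ _) (runProb_pos hm _ _)).le
  sum_le w := by
    have h : ∀ a, m (w.foldl step s₀) a *
        (wordLZ [] (w ++ [a]) / runProb step m s₀ (w ++ [a])) =
        wordLZ [] w / runProb step m s₀ w * condLZ a w := by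
      intro a
      have h1 := (hm (w.foldl step s₀) a).ne'
      have h2 := (runProb_pos (step := step) hm s₀ w).ne'
      rw [wordLZ_append_singleton, runProb_append_singleton, List.nil_append]
      field_simp
    simp only [h, ← Finset.mul_sum]
    exact mul_le_of_le_one_right (div_pos (wordLZ_pos _ _) (runProb_pos hm _ _)).le
      (sum_condLZ_le_one w)

end Supermartingale

/-! ### From supermartingales to prudent strategies. -/

section Strategy

theorem IsPlay.forecast_eq {Ω : Type*} [Fintype Ω] {k : ℕ} {M : Ω → (Fin k → Ω) → ℝ}
    {p : ℕ → Ω → ℝ} {ω : ℕ → Ω} (h : IsPlay M p ω) (s₀ : Fin k → Ω) {n : ℕ} (hn : k ≤ n) (a : Ω) :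
    p n a = M a ((pre ω n).foldl shift s₀) := by
  rw [h.markov n hn]
  congr 1
  ext i
  rw [foldl_shift_pre _ _ _ _ (by omega)]
  congr 1
  omega

variable {Ω : Type*} [Fintype Ω] [DecidableEq Ω] {k : ℕ}

/-- The strategy that does not bet in the first `k` rounds and then follows `F`. -/
noncomputable def followStrategy (k : ℕ) (F : List Ω → ℝ) (w : List Ω) (a : Ω) : ℝ :=
  if w.length < k then 0 else F (w ++ [a]) / F w

variable {M : Ω → (Fin k → Ω) → ℝ} {F : List Ω → ℝ} {p : ℕ → Ω → ℝ} {ω : ℕ → Ω}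

theorem capital_followStrategy_of_le {n : ℕ} (hn : n ≤ k) :
    capital (followStrategy k F) p ω n = 1 := by
  induction n with
  | zero => rfl
  | succ n ih =>
    have : n < k := hn
    simp [capital, ih this.le, followStrategy, this]

/-- A bet multiplies the capital by F(wa)/F(w) plus 1 minus the mean of that ratio, and this
difference is nonnegative. Forecasts are free in the first `k` rounds, so the comparison starts at
time `k` with capital 1. -/
theorem div_le_capital_followStrategy {s₀ : Fin k → Ω}
    (hF : IsSupermartingale shift (fun s a => M a s) s₀ F) (hpos : ∀ w, 0 < F w)
    (h : IsPlay M p ω) {n : ℕ} (hn : k ≤ n) :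
    F (pre ω n) / F (pre ω k) ≤ capital (followStrategy k F) p ω n := by
  induction n, hn using Nat.le_induction with
  | base => rw [capital_followStrategy_of_le le_rfl, div_self (hpos _).ne']
  | succ n hn ih =>
    have hfac : F (pre ω (n + 1)) / F (pre ω n) ≤
        1 + ∑ a, followStrategy k F (pre ω n) a * ((if ω n = a then 1 else 0) - p n a) := by
      have h1 : ∑ a, followStrategy k F (pre ω n) a * ((if ω n = a then 1 else 0) - p n a) =
          F (pre ω (n + 1)) / F (pre ω n) -
            (∑ a, M a ((pre ω n).foldl shift s₀) * F (pre ω n ++ [a])) / F (pre ω n) := by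
        have hfs : ∀ a, followStrategy k F (pre ω n) a = F (pre ω n ++ [a]) / F (pre ω n) :=
          fun a => if_neg (by simpa using hn)
        simp only [hfs, mul_sub, Finset.sum_sub_distrib, mul_ite, mul_one, mul_zero,
          Finset.sum_ite_eq, Finset.mem_univ, if_true, pre_succ, Finset.sum_div]
        congr 1
        refine Finset.sum_congr rfl fun a _ => ?_
        rw [h.forecast_eq s₀ hn]
        ring
      have h2 : (∑ a, M a ((pre ω n).foldl shift s₀) * F (pre ω n ++ [a])) / F (pre ω n) ≤ 1 :=
        div_le_one_of_le₀ (hF.sum_le _) (hpos _).le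
      rw [h1]
      linarith
    calc F (pre ω (n + 1)) / F (pre ω k)
        = F (pre ω n) / F (pre ω k) * (F (pre ω (n + 1)) / F (pre ω n)) := by
          have := (hpos (pre ω n)).ne'
          have := (hpos (pre ω k)).ne'
          field_simp
      _ ≤ _ := mul_le_mul ih hfac (div_pos (hpos _) (hpos _)).le
          ((div_pos (hpos _) (hpos _)).le.trans ih)

theorem isPrudent_followStrategy {s₀ : Fin k → Ω}
    (hF : IsSupermartingale shift (fun s a => M a s) s₀ F) (hpos : ∀ w, 0 < F w) :
    IsPrudent M (followStrategy k F) := by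
  intro p ω h n
  rcases le_total n k with hn | hn
  · rw [capital_followStrategy_of_le hn]
    exact one_pos
  · exact (div_pos (hpos _) (hpos _)).trans_le (div_le_capital_followStrategy hF hpos h hn)

theorem tendsto_capital_followStrategy {s₀ : Fin k → Ω}
    (hF : IsSupermartingale shift (fun s a => M a s) s₀ F) (hpos : ∀ w, 0 < F w)
    (h : IsPlay M p ω) (ht : Tendsto (fun n => F (pre ω n)) atTop atTop) :
    Tendsto (capital (followStrategy k F) p ω) atTop atTop :=
  tendsto_atTop_mono' _ ((eventually_ge_atTop k).mono fun _ hn =>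
    div_le_capital_followStrategy hF hpos h hn) (ht.atTop_div_const (hpos _))

end Strategy

/-! ### Redundancy of the Lempel–Ziv code. -/

section Ziv

variable {Ω S : Type*} [Fintype Ω] [DecidableEq Ω] [Fintype S] [Nonempty S]
  {step : S → Ω → S} {m : S → Ω → ℝ}

/-- By log y = 2 log √y ≤ 2√y; the right side is o(n) as soon as T = o(n). -/
theorem mul_log_add_div_le_sqrt {T n : ℝ} (hT : 0 ≤ T) (hn : 0 ≤ n) :
    T * Real.log ((n + T) / T) ≤ 2 * √(T * (n + T)) := by
  rcases hT.eq_or_lt with rfl | hT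
  · simp
  have h1 : Real.log ((n + T) / T) ≤ 2 * √((n + T) / T) := by
    have h2 := Real.log_sqrt (x := (n + T) / T) (by positivity)
    have h3 := Real.log_le_sub_one_of_pos (x := √((n + T) / T)) (by positivity)
    linarith
  have h4 : T * √((n + T) / T) = √(T * (n + T)) := by
    rw [← Real.sqrt_sq (show 0 ≤ T * √((n + T) / T) by positivity), mul_pow,
      Real.sq_sqrt (by positivity)]
    congr 1
    field_simp
  calc T * Real.log ((n + T) / T) ≤ T * (2 * √((n + T) / T)) := by gcongr
    _ = 2 * (T * √((n + T) / T)) := by ring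
    _ = _ := by rw [h4]

theorem succ_mul_log_succ_sub_le {T : ℝ} (hT : 0 ≤ T) :
    (T + 1) * Real.log (T + 1) - T * Real.log T ≤ T + 1 := by
  rcases hT.eq_or_lt with rfl | hT
  · simp
  have h1 := Real.log_le_sub_one_of_pos (x := T + 1) (by positivity)
  have h2 := Real.log_le_sub_one_of_pos (x := (T + 1) / T) (by positivity)
  rw [Real.log_div (by positivity) hT.ne'] at h2
  have h3 := mul_le_mul_of_nonneg_left h2 hT.le
  have h4 : T * ((T + 1) / T - 1) = 1 := by field_simp; ring
  rw [h4] at h3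
  linarith

/-- The Lempel–Ziv code length exceeds the ideal code length of a finite-state source by little,
in terms of the number of phrases. -/
theorem neg_log_wordLZ_le_add [Nonempty Ω] (hm : ∀ s a, 0 < m s a)
    (hsum : ∀ s, ∑ a, m s a = 1) (s : S) (w : List Ω) :
    -Real.log (wordLZ [] w) ≤ -Real.log (runProb step m s w) +
      (((parse w).1.length + 1) * (Real.log (Fintype.card Ω) + 1) +
        (parse w).1.length * Real.log (Fintype.card S) +
        4 * √((parse w).1.length * (w.length + (parse w).1.length))) := by
  have hP := log_runProb_le_of_nodup (step := step) hm hsum s _ (parse_nodup w)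
    (ne_nil_of_mem_parse w) (length_flatten_parse_le w)
  -- Dropping the incomplete last phrase can only raise the probability.
  have hw : Real.log (runProb step m s w) ≤ Real.log (runProb step m s (parse w).1.flatten) := by
    refine Real.log_le_log (runProb_pos hm _ _) ?_
    conv_lhs => rw [← parse_flatten w]
    rw [runProb_append]
    refine mul_le_of_le_one_right (runProb_pos hm _ _).le ?_
    simpa using sum_runProb_le_one hm hsum (parse w).2.length _ {(parse w).2} (by simp)
  have hQ := neg_log_wordLZ_le w
  set T : ℝ := ((parse w).1.length : ℝ)
  have hT : 0 ≤ T := Nat.cast_nonneg _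
  have hA : (0 : ℝ) < Fintype.card Ω := Nat.cast_pos.2 Fintype.card_pos
  have hS : (0 : ℝ) < Fintype.card S := Nat.cast_pos.2 Fintype.card_pos
  rw [Real.log_mul hA.ne' (by positivity)] at hQ
  have hlogS : T * Real.log (Fintype.card S / T) =
      T * Real.log (Fintype.card S) - T * Real.log T := by
    rcases hT.eq_or_lt with h | h
    · simp [← h]
    · rw [Real.log_div hS.ne' h.ne', mul_sub]
  have h1 := mul_log_add_div_le_sqrt hT (Nat.cast_nonneg (α := ℝ) w.length)
  -- The main terms (T+1) log(T+1) of the code and T log T of Ziv's inequality cancel up to T + 1.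
  have h2 := succ_mul_log_succ_sub_le hT
  rw [hlogS] at hP
  linarith

/-- The redundancy of the Lempel–Ziv code is asymptotically negligible. -/
theorem tendsto_redundancy (ω : ℕ → Ω) (c d : ℝ) :
    Tendsto (fun n : ℕ => ((((parse (pre ω n)).1.length : ℝ) + 1) * c +
        (parse (pre ω n)).1.length * d +
        4 * √((parse (pre ω n)).1.length * (n + (parse (pre ω n)).1.length))) / n)
      atTop (𝓝 0) := by
  have hT := tendsto_length_parse_div ω
  have h1 : Tendsto (fun n : ℕ => 1 / (n : ℝ)) atTop (𝓝 0) := tendsto_one_div_atTop_nhds_zero_nat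
  have hlim := (((hT.add h1).mul_const c).add (hT.mul_const d)).add
    ((((hT.mul (hT.const_add 1)).sqrt)).const_mul 4)
  simp only [add_zero, zero_mul, Real.sqrt_zero, mul_zero] at hlim
  refine hlim.congr' ?_
  filter_upwards [eventually_gt_atTop 0] with n hn
  have hn0 : (0 : ℝ) < n := Nat.cast_pos.2 hn
  set T : ℝ := ((parse (pre ω n)).1.length : ℝ)
  have hs : √(T / n * (1 + T / n)) = √(T * (n + T)) / n := by
    have : T / n * (1 + T / n) = T * (n + T) / (n : ℝ) ^ 2 := by field_simp
    rw [this, Real.sqrt_div' _ (by positivity), Real.sqrt_sq hn0.le]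
  rw [hs]
  field_simp

end Ziv

/-! ### Averages controlled by exponential supermartingales. -/

section LawOfLargeNumbers

theorem tendsto_one_add_two_log_div_sqrt :
    Tendsto (fun n : ℕ => (1 + 2 * Real.log n) / √n) atTop (𝓝 0) := by
  have h1 : Tendsto (fun n : ℕ => Real.log n / √n) atTop (𝓝 0) := by
    have := (isLittleO_log_rpow_atTop (r := 1 / 2) (by norm_num)).tendsto_div_nhds_zero.comp
      (tendsto_natCast_atTop_atTop (R := ℝ))
    refine this.congr fun n => ?_
    simp [Real.sqrt_eq_rpow]
  have h2 : Tendsto (fun n : ℕ => 1 / √(n : ℝ)) atTop (𝓝 0) := by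
    simpa [Function.comp_def] using tendsto_inv_atTop_zero.comp
      (Real.tendsto_sqrt_atTop.comp (tendsto_natCast_atTop_atTop (R := ℝ)))
  have := h2.add (h1.const_mul 2)
  simp only [mul_zero, add_zero] at this
  refine this.congr fun n => ?_
  ring

theorem tendsto_two_log_div : Tendsto (fun n : ℕ => 2 * Real.log n / n) atTop (𝓝 0) := by
  have := (Real.isLittleO_log_id_atTop.tendsto_div_nhds_zero.comp
    (tendsto_natCast_atTop_atTop (R := ℝ))).const_mul 2
  simp only [mul_zero] at this
  refine this.congr fun n => ?_
  simp [mul_div_assoc]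

/-- The exponent at which the exponential supermartingale is used at time `n`. -/
noncomputable def rate (C : ℝ) (n : ℕ) : ℝ := 1 / (C * √n)

theorem abs_rate_mul_le {C : ℝ} (hC : 0 < C) (n : ℕ) : |rate C n| * C ≤ 1 := by
  rcases n.eq_zero_or_pos with rfl | hn
  · simp [rate]
  have h1 : 1 ≤ √(n : ℝ) := Real.one_le_sqrt.2 (by exact_mod_cast hn)
  rw [rate, abs_of_nonneg (by positivity), div_mul_eq_mul_div, one_mul,
    div_le_one (by positivity)]
  nlinarith

/-- If the exponential supermartingales stay small, then the averages tend to zero. -/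
theorem tendsto_div_of_exp_lt {x : ℕ → ℝ} {C : ℝ} (hC : 0 < C)
    (h : ∀ᶠ n : ℕ in atTop,
      Real.exp (rate C n * x n - rate C n ^ 2 * C ^ 2 * n) < (n : ℝ) ^ 2 ∧
      Real.exp (-rate C n * x n - (-rate C n) ^ 2 * C ^ 2 * n) < (n : ℝ) ^ 2) :
    Tendsto (fun n : ℕ => x n / n) atTop (𝓝 0) := by
  refine squeeze_zero_norm' ?_ (by simpa using tendsto_one_add_two_log_div_sqrt.const_mul C)
  filter_upwards [h, eventually_gt_atTop 0] with n hn hn0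
  have hn0 : (0 : ℝ) < n := Nat.cast_pos.2 hn0
  have hsq : 0 < √(n : ℝ) := Real.sqrt_pos.2 hn0
  have hss : √(n : ℝ) * √(n : ℝ) = n := Real.mul_self_sqrt hn0.le
  -- The rate makes the quadratic correction exactly 1, so both bounds together give |x n| ≤ C√n (1
  -- + 2 log n).
  have hone : rate C n ^ 2 * C ^ 2 * n = 1 := by
    rw [rate, div_pow, mul_pow, Real.sq_sqrt hn0.le]
    field_simp
  rw [neg_sq, hone, ← Real.lt_log_iff_exp_lt (by positivity),
    ← Real.lt_log_iff_exp_lt (by positivity), Real.log_pow] at hn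
  obtain ⟨h1, h2⟩ := hn
  have habs : rate C n * |x n| ≤ 1 + 2 * Real.log n := by
    push_cast at h1 h2
    rcases abs_cases (x n) with ⟨h, _⟩ | ⟨h, _⟩ <;> rw [h] <;> linarith
  rw [rate, div_mul_eq_mul_div, one_mul, div_le_iff₀ (by positivity)] at habs
  rw [Real.norm_eq_abs, abs_div, abs_of_pos hn0, div_le_iff₀ hn0]
  calc |x n| ≤ (1 + 2 * Real.log n) * (C * √n) := habs
    _ = C * ((1 + 2 * Real.log n) / √n) * n := by
      have : √(n : ℝ) = n / √n := by rw [eq_div_iff hsq.ne', hss]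
      rw [div_eq_mul_inv, mul_assoc C, mul_assoc _ _ (n : ℝ), mul_comm _ (n : ℝ),
        ← div_eq_mul_inv, ← this]
      ring

end LawOfLargeNumbers

/-! ### Assembly. -/

/-- A single family of supermartingales detects every deviation of the Lempel–Ziv code length per
letter from the number `H`, provided that the Poisson equation for `H` has the solution `g`. -/
theorem exists_supermartingale_of_poisson {Ω S : Type*} [Fintype Ω] [DecidableEq Ω] [Nonempty Ω]
    [Fintype S] {step : S → Ω → S} {m : S → Ω → ℝ} (hm : ∀ s a, 0 < m s a)
    (hsum : ∀ s, ∑ a, m s a = 1) (s₀ : S) {H : ℝ} {g : S → ℝ}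
    (hg : ∀ s, -∑ a, m s a * Real.log (m s a) - H = g s - ∑ a, m s a * g (step s a)) :
    ∃ F : List Ω → ℝ, IsSupermartingale step m s₀ F ∧ (∀ w, 0 < F w) ∧
      ∀ ω : ℕ → Ω, ¬ Tendsto (fun n : ℕ => -Real.log (probLZ ω n) / (n : ℝ)) atTop (𝓝 H) →
        Tendsto (fun n => F (pre ω n)) atTop atTop := by
  have : Nonempty S := ⟨s₀⟩
  obtain ⟨δ, hδ, hδm⟩ : ∃ δ : ℝ, 0 < δ ∧ ∀ s a, δ ≤ m s a := by
    obtain ⟨x, -, hx⟩ := Finset.exists_min_image (Finset.univ : Finset (S × Ω))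
      (fun x => m x.1 x.2) Finset.univ_nonempty
    exact ⟨m x.1 x.2, hm _ _, fun s a => hx (s, a) (Finset.mem_univ _)⟩
  -- By the Poisson equation, adding the increment of `g` centres the log-loss minus `H`; along a
  -- word it telescopes to a bounded term.
  let h : S → Ω → ℝ := fun s a => -Real.log (m s a) - H + g (step s a) - g s
  have hmean : ∀ s, ∑ a, m s a * h s a = 0 := fun s => by
    have : ∑ a, m s a * h s a = -∑ a, m s a * Real.log (m s a) - (∑ a, m s a) * H +
        ∑ a, m s a * g (step s a) - (∑ a, m s a) * g s := by
      simp only [Finset.sum_mul, ← Finset.sum_neg_distrib, ← Finset.sum_sub_distrib,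
        ← Finset.sum_add_distrib]
      exact Finset.sum_congr rfl fun a _ => by simp only [h]; ring
    rw [this, hsum]
    linarith [hg s]
  obtain ⟨C, hC0, hC⟩ : ∃ C : ℝ, 0 < C ∧ ∀ s a, |h s a| ≤ C := by
    obtain ⟨x, -, hx⟩ := Finset.exists_max_image (Finset.univ : Finset (S × Ω))
      (fun x => |h x.1 x.2|) Finset.univ_nonempty
    exact ⟨|h x.1 x.2| + 1, by positivity, fun s a =>
      (hx (s, a) (Finset.mem_univ _)).trans (le_add_of_nonneg_right zero_le_one)⟩
  let X : List Ω → ℝ := fun w =>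
    -Real.log (runProb step m s₀ w) - w.length * H + g (w.foldl step s₀) - g s₀
  have hX : ∀ w a, X (w ++ [a]) = X w + h (w.foldl step s₀) a := fun w a => by
    simp only [X, h, runProb_append_singleton, List.foldl_append, List.foldl_cons, List.foldl_nil,
      List.length_append, List.length_singleton, Nat.cast_add, Nat.cast_one,
      Real.log_mul (runProb_pos hm s₀ w).ne' (hm _ _).ne']
    ring
  have hX0 : X [] = 0 := by simp [X, runProb]
  let V : ℝ → List Ω → ℝ := fun l w => Real.exp (l * X w - l ^ 2 * C ^ 2 * w.length)
  have hV : ∀ l, |l| * C ≤ 1 → IsSupermartingale step m s₀ (V l) := fun l hl =>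
    isSupermartingale_exp hm hsum hmean hC hX hl
  have hQP : IsSupermartingale step m s₀ fun w => wordLZ [] w / runProb step m s₀ w :=
    isSupermartingale_wordLZ_div hm
  have hrate := abs_rate_mul_le hC0
  have hW := fun N : ℕ => (hQP.add (hV (rate C N) (hrate N))).add
    (hV (-rate C N) (by rw [abs_neg]; exact hrate N))
  -- Each of the three summands starts at 1. As all are nonnegative, a bound on their sum bounds
  -- each of them.
  obtain ⟨F, hF, hpos, hlim⟩ := exists_supermartingale_tendsto_atTop hm hsum hδ hδm hW (B := 3)
    (fun N => by simp [V, hX0, wordLZ, runProb]; norm_num)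
  refine ⟨F, hF, hpos, fun ω => not_imp_comm.1 fun hnot => ?_⟩
  have hev := not_frequently.1 (mt (hlim ω) hnot)
  simp only [not_le] at hev
  have hxlim : Tendsto (fun n : ℕ => X (pre ω n) / n) atTop (𝓝 0) := by
    refine tendsto_div_of_exp_lt hC0 (hev.mono fun n hn => ?_)
    have h1 := hQP.nonneg (pre ω n)
    have h2 := (hV _ (hrate n)).nonneg (pre ω n)
    have h3 := Real.exp_pos (-rate C n * X (pre ω n) - (-rate C n) ^ 2 * C ^ 2 * n)
    simp only [V, length_pre] at hn h1 h2
    constructor <;> linarith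
  have hlogP : Tendsto (fun n : ℕ => -Real.log (runProb step m s₀ (pre ω n)) / n) atTop
      (𝓝 H) := by
    obtain ⟨G, hG⟩ : ∃ G : ℝ, ∀ s, |g s - g s₀| ≤ G := by
      obtain ⟨x, -, hx⟩ := Finset.exists_max_image Finset.univ (fun s => |g s - g s₀|)
        Finset.univ_nonempty
      exact ⟨_, fun s => hx s (Finset.mem_univ _)⟩
    have hglim : Tendsto (fun n : ℕ => (g ((pre ω n).foldl step s₀) - g s₀) / n) atTop (𝓝 0) := by
      refine squeeze_zero_norm (fun n => ?_) (tendsto_const_div_atTop_nhds_zero_nat G)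
      rw [Real.norm_eq_abs, abs_div, Nat.abs_cast]
      gcongr
      exact hG _
    have := (hxlim.sub hglim).const_add H
    simp only [sub_zero, add_zero] at this
    refine this.congr' ?_
    filter_upwards [eventually_gt_atTop 0] with n hn
    have hn0 : (n : ℝ) ≠ 0 := Nat.cast_ne_zero.2 hn.ne'
    simp only [X, length_pre]
    field_simp
    ring
  have hlow := hlogP.sub tendsto_two_log_div
  have hup := hlogP.add (tendsto_redundancy ω (Real.log (Fintype.card Ω) + 1)
    (Real.log (Fintype.card S)))
  rw [sub_zero] at hlow
  rw [add_zero] at hup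
  simp only [probLZ_eq_wordLZ]
  refine tendsto_of_tendsto_of_tendsto_of_le_of_le' hlow hup ?_ ?_
  · filter_upwards [hev, eventually_gt_atTop 0] with n hn hn0
    have hn0 : (0 : ℝ) < n := Nat.cast_pos.2 hn0
    have h2 := (hV _ (hrate n)).nonneg (pre ω n)
    have h3 := (hV (-rate C n) (by rw [abs_neg]; exact hrate n)).nonneg (pre ω n)
    have h4 : wordLZ [] (pre ω n) / runProb step m s₀ (pre ω n) ≤ (n : ℝ) ^ 2 := by linarith
    have hq := wordLZ_pos [] (pre ω n)
    have hp := runProb_pos (step := step) hm s₀ (pre ω n)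
    have h5 := Real.log_le_log (div_pos hq hp) h4
    rw [Real.log_div hq.ne' hp.ne', Real.log_pow] at h5
    push_cast at h5
    rw [← sub_div]
    gcongr
    linarith
  · refine Eventually.of_forall fun n => ?_
    rw [← add_div]
    have := neg_log_wordLZ_le_add (step := step) hm hsum s₀ (pre ω n)
    rw [length_pre] at this
    gcongr

end LZGame

theorem mainTheorem2 {Ω : Type*} [Fintype Ω] [DecidableEq Ω] (k : ℕ)
    (M : Ω → (Fin k → Ω) → ℝ) (hM : LZGame.IsMarkovKernel M)
    (π : (Fin k → Ω) → ℝ) (hπ : LZGame.IsStationary M π) :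
    ∃ α : List Ω → Ω → ℝ, LZGame.IsPrudent M α ∧
      ∀ (p : ℕ → Ω → ℝ) (ω : ℕ → Ω), LZGame.IsPlay M p ω →
        ¬ Filter.Tendsto (fun n : ℕ => -Real.log (LZGame.probLZ ω n) / (n : ℝ)) Filter.atTop
            (nhds (LZGame.entropyRate M π)) →
        Filter.Tendsto (LZGame.capital α p ω) Filter.atTop Filter.atTop := by
  rcases isEmpty_or_nonempty Ω with hΩ | ⟨⟨a₀⟩⟩
  -- Over an empty alphabet Reality has no sequence to play.
  · exact ⟨0, fun p ω => isEmptyElim (ω 0), fun p ω => isEmptyElim (ω 0)⟩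
  have : Nonempty Ω := ⟨a₀⟩
  have hm : ∀ (s : Fin k → Ω) (a : Ω), 0 < M a s := fun s a => ((hM s).mem_Ioo a).1
  have hsum : ∀ s : Fin k → Ω, ∑ a, M a s = 1 := fun s => (hM s).sum_eq_one
  obtain ⟨g, hg⟩ := LZGame.exists_poisson (m := fun s a => M a s) hm hsum
    LZGame.exists_foldl_shift_eq hπ.sum_eq_one hπ.sum_shift
    (fun s => -∑ a, M a s * Real.log (M a s))
  have hH : ∑ t, π t * -∑ a, M a t * Real.log (M a t) = LZGame.entropyRate M π := by
    simp [LZGame.entropyRate]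
  rw [hH] at hg
  -- The constant initial window is an arbitrary choice, overwritten after `k` rounds.
  obtain ⟨F, hF, hpos, hlim⟩ := LZGame.exists_supermartingale_of_poisson
    (m := fun s a => M a s) hm hsum (fun _ => a₀) hg
  exact ⟨LZGame.followStrategy k F, LZGame.isPrudent_followStrategy hF hpos,
    fun p ω hplay hnot => LZGame.tendsto_capital_followStrategy hF hpos hplay (hlim ω hnot)⟩
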